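/- Let $d(j)$ denote the number of positive divisors of $j$, let $\gamma$ be Euler's constant and let $\log$ be the natural logarithm. For all real numbers $q$ with $0<q<1$ the series $\sum_{k=2}^\infty \sum_{j=1}^{k-1}\frac{d(j)}{k-j}\,q^k$ converges and $$ \lambda_0\,\frac{q\log(1-q)}{1-q}-\frac{\log^2(1-q)}{\log q} <\sum_{k=2}^\infty\sum_{j=1}^{k-1}\frac{d(j)}{k-j}\,q^k< \mu_0\,\frac{q\log(1-q)}{1-q}-\frac{\log^2(1-q)}{\log q} $$ with $\lambda_0=-\gamma$ and $\mu_0=-1$. These constants are best possible: if $\lambda_0$ is a real number such that the left-hand inequality holds for all $q\in(0,1)$, then $\lambda_0\ge-\gamma$; and if $\mu_0$ is a real number such that the right-hand inequality holds for all $q\in(0,1)$, then $\mu_0\le-1$. -/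

import Mathlib

/-- The coefficient `∑_{j=1}^{k-1} d(j) / (k - j)`, where `d(j)` is the number of positive
divisors of `j`. The subtraction and the division take place in the real numbers. -/
noncomputable def divisorConvCoeff (k : ℕ) : ℝ :=
  ∑ j ∈ Finset.Ico 1 k, (j.divisors.card : ℝ) / ((k : ℝ) - (j : ℝ))

/-- The power series `∑_{k=2}^∞ (∑_{j=1}^{k-1} d(j) / (k - j)) q^k`; the summation index is
shifted by two so that it runs over all natural numbers. -/
noncomputable def divisorConvSeries (q : ℝ) : ℝ :=
  ∑' n : ℕ, divisorConvCoeff (n + 2) * q ^ (n + 2)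

open Filter Topology

/-! The series is the Cauchy product of `∑ d(j) q^j`, which is the Lambert series `∑ q^n / (1 -
q^n)`, with `-log (1 - q)`. For `q = e^{-t}`, splitting `1 / (e^c - 1) = e^{-c} φ(c) + e^{-c} / c`
at `c = nt` extracts the logarithmic main term and leaves `A(t) / (e^t - 1)`, with `A =
lambertAverage` a mean of `φ` under geometric weights of total mass one. Both inequalities then
amount to `γ < A(t) < 1`. The upper bound holds because `φ < 1`, and is sharp as `t → ∞` since the
first term alone gives `A(t) ≥ 1 - 1/t`. For the lower bound, `A(s) < A(2s)` since `φ` increases,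
and `A(t) → γ` as `t → 0`; halving `t` repeatedly gives `γ < A(t)`. Full monotonicity of `A` is not
needed. -/

/-- The function `c ↦ 1 / (1 - e^{-c}) - 1 / c`. -/
noncomputable def lambertKernel (c : ℝ) : ℝ := 1 / (1 - Real.exp (-c)) - 1 / c

/-- The average `(e^t - 1) ∑_{k ≥ 1} e^{-kt} φ(kt)` of the kernel
`φ(c) = 1 / (1 - e^{-c}) - 1 / c`. -/
noncomputable def lambertAverage (t : ℝ) : ℝ :=
  (Real.exp t - 1) * ∑' n : ℕ, Real.exp (-((n + 1) * t)) * lambertKernel ((n + 1) * t)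

/-- This is `c/2 < sinh (c/2)` multiplied by `2 e^{-c/2}`. It makes the kernel's derivative positive
and later supplies the `1/n²` domination. -/
lemma mul_exp_neg_half_lt_one_sub_exp_neg {c : ℝ} (hc : 0 < c) :
    c * Real.exp (-(c / 2)) < 1 - Real.exp (-c) := by
  have h := Real.self_lt_sinh_iff.2 (half_pos hc)
  rw [Real.sinh_eq] at h
  have h1 : Real.exp (c / 2) * Real.exp (-(c / 2)) = 1 := by rw [← Real.exp_add]; simp
  have h2 : Real.exp (-(c / 2)) * Real.exp (-(c / 2)) = Real.exp (-c) := by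
    rw [← Real.exp_add]; ring_nf
  nlinarith [Real.exp_pos (-(c / 2))]

lemma one_sub_exp_neg_pos {c : ℝ} (hc : 0 < c) : 0 < 1 - Real.exp (-c) := by
  have : Real.exp (-c) < 1 := Real.exp_lt_one_iff.2 (by linarith)
  linarith

lemma lambertKernel_pos {c : ℝ} (hc : 0 < c) : 0 < lambertKernel c := by
  have h : 1 - Real.exp (-c) < c := by
    have := Real.add_one_lt_exp (x := -c) (by linarith)
    linarith
  exact sub_pos.2 (one_div_lt_one_div_of_lt (one_sub_exp_neg_pos hc) h)

lemma lambertKernel_lt_one {c : ℝ} (hc : 0 < c) : lambertKernel c < 1 := by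
  have h := one_sub_exp_neg_pos hc
  have h1 : (1 + c) * Real.exp (-c) < 1 := by
    have h2 := Real.add_one_lt_exp (x := c) hc.ne'
    have h3 : Real.exp c * Real.exp (-c) = 1 := by rw [← Real.exp_add]; simp
    nlinarith [Real.exp_pos (-c)]
  rw [lambertKernel, sub_lt_iff_lt_add, div_lt_iff₀ h]
  field_simp
  linarith

lemma lambertKernel_strictMonoOn : StrictMonoOn lambertKernel (Set.Ioi 0) := by
  have hd : ∀ c ∈ Set.Ioi (0 : ℝ), HasDerivAt lambertKernel
      (-(Real.exp (-c)) / (1 - Real.exp (-c)) ^ 2 + 1 / c ^ 2) c := by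
    intro c hc
    have hc : 0 < c := hc
    have h := one_sub_exp_neg_pos hc
    have h1 : HasDerivAt (fun x : ℝ => 1 - Real.exp (-x)) (Real.exp (-c)) c := by
      simpa using ((hasDerivAt_neg c).exp).const_sub 1
    have h2 := (h1.inv h.ne').sub (hasDerivAt_inv hc.ne')
    have h3 : lambertKernel = (fun x : ℝ => 1 - Real.exp (-x))⁻¹ - fun x : ℝ => x⁻¹ := by
      funext x
      simp [lambertKernel]
    rw [h3]
    simpa only [sub_neg_eq_add, one_div] using! h2
  refine strictMonoOn_of_deriv_pos (convex_Ioi 0)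
    (fun c hc => (hd c hc).continuousAt.continuousWithinAt) fun c hc => ?_
  rw [interior_Ioi] at hc
  rw [(hd c hc).deriv]
  have hc : 0 < c := hc
  have h := one_sub_exp_neg_pos hc
  have h1 := mul_exp_neg_half_lt_one_sub_exp_neg hc
  have h2 : Real.exp (-(c / 2)) ^ 2 = Real.exp (-c) := by
    rw [← Real.exp_nat_mul]; push_cast; ring_nf
  have h3 : c ^ 2 * Real.exp (-c) < (1 - Real.exp (-c)) ^ 2 := by
    rw [← h2, ← mul_pow, h2]
    exact pow_lt_pow_left₀ h1 (by positivity) two_ne_zero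
  rw [neg_div, neg_add_eq_sub, sub_pos, div_lt_div_iff₀ (by positivity) (by positivity)]
  linarith

/-! ### Bounds and doubling for the geometric average -/

lemma exp_neg_succ_mul (t : ℝ) (n : ℕ) :
    Real.exp (-((n + 1) * t)) = Real.exp (-t) ^ (n + 1) := by
  rw [← Real.exp_nat_mul]; push_cast; ring_nf

lemma hasSum_exp_neg_succ_mul {t : ℝ} (ht : 0 < t) :
    HasSum (fun n : ℕ => Real.exp (-((n + 1) * t))) (1 / (Real.exp t - 1)) := by
  have h := one_sub_exp_neg_pos ht
  have := (hasSum_geometric_of_lt_one (Real.exp_pos (-t)).le (by linarith)).mul_left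
    (Real.exp (-t))
  have hval : 1 / (Real.exp t - 1) = Real.exp (-t) * (1 - Real.exp (-t))⁻¹ := by
    have h1 : Real.exp t * Real.exp (-t) = 1 := by rw [← Real.exp_add]; simp
    have h2 : Real.exp t - 1 ≠ 0 := by
      have := Real.add_one_lt_exp ht.ne'
      linarith
    rw [← div_eq_mul_inv, div_eq_div_iff h2 h.ne']
    linarith
  rw [hval]
  simpa only [exp_neg_succ_mul, pow_succ'] using this

lemma summable_lambertAverage {t : ℝ} (ht : 0 < t) :
    Summable fun n : ℕ => Real.exp (-((n + 1) * t)) * lambertKernel ((n + 1) * t) := by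
  refine Summable.of_nonneg_of_le (fun n => ?_) (fun n => ?_) (hasSum_exp_neg_succ_mul ht).summable
  · exact mul_nonneg (Real.exp_pos _).le (lambertKernel_pos (by positivity)).le
  · exact mul_le_of_le_one_right (Real.exp_pos _).le (lambertKernel_lt_one (by positivity)).le

lemma exp_sub_one_pos {t : ℝ} (ht : 0 < t) : 0 < Real.exp t - 1 := by
  have := Real.add_one_lt_exp ht.ne'
  linarith

lemma lambertAverage_lt_one {t : ℝ} (ht : 0 < t) : lambertAverage t < 1 := by
  have h := exp_sub_one_pos ht
  have hs := hasSum_exp_neg_succ_mul ht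
  have h1 : ∑' n : ℕ, Real.exp (-((n + 1) * t)) * lambertKernel ((n + 1) * t)
      < ∑' n : ℕ, Real.exp (-((n + 1) * t)) := by
    have hlt : ∀ n : ℕ, Real.exp (-((n + 1) * t)) * lambertKernel ((n + 1) * t)
        < Real.exp (-((n + 1) * t)) := fun n =>
      mul_lt_of_lt_one_right (Real.exp_pos _) (lambertKernel_lt_one (by positivity))
    exact (summable_lambertAverage ht).tsum_lt_tsum (fun n => (hlt n).le) (hlt 0) hs.summable
  rw [hs.tsum_eq, lt_div_iff₀ h] at h1
  rw [lambertAverage]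
  linarith

lemma one_sub_inv_le_lambertAverage {t : ℝ} (ht : 0 < t) : 1 - 1 / t ≤ lambertAverage t := by
  have h := one_sub_exp_neg_pos ht
  have h0 : Real.exp (-t) * lambertKernel t
      ≤ ∑' n : ℕ, Real.exp (-((n + 1) * t)) * lambertKernel ((n + 1) * t) := by
    have := (summable_lambertAverage ht).le_tsum 0
      fun n _ => mul_nonneg (Real.exp_pos _).le (lambertKernel_pos (by positivity)).le
    simpa using this
  have h1 := mul_le_mul_of_nonneg_left h0 (exp_sub_one_pos ht).le
  refine le_trans ?_ h1
  have h2 : Real.exp t * Real.exp (-t) = 1 := by rw [← Real.exp_add]; simp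
  have h3 : (Real.exp t - 1) * (Real.exp (-t) * lambertKernel t)
      = 1 - (1 - Real.exp (-t)) / t := by
    rw [← mul_assoc, sub_mul, h2, lambertKernel]
    field_simp
  rw [h3]
  gcongr
  linarith [Real.exp_pos (-t)]

/-- Even multiples of `s` reproduce the sum for `2s`; each odd multiple is compared with the next
even one, costing a factor `e^s`. The total factor `e^s + 1` turns `e^s - 1` into `e^{2s} - 1`. -/
lemma lambertAverage_lt_lambertAverage_two_mul {s : ℝ} (hs : 0 < s) :
    lambertAverage s < lambertAverage (2 * s) := by
  have hsum := summable_lambertAverage hs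
  have hsum2 := summable_lambertAverage (t := 2 * s) (by positivity)
  set h : ℕ → ℝ := fun n => Real.exp (-((n + 1) * s)) * lambertKernel ((n + 1) * s) with hh
  set H : ℕ → ℝ := fun n =>
    Real.exp (-((n + 1) * (2 * s))) * lambertKernel ((n + 1) * (2 * s)) with hH
  have hodd : ∀ k, h (2 * k + 1) = H k := by
    intro k
    simp only [hh, hH]
    push_cast
    ring_nf
  have heven : ∀ k, h (2 * k) < Real.exp s * H k := by
    intro k
    have hk : lambertKernel ((2 * k + 1) * s) < lambertKernel ((k + 1) * (2 * s)) :=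
      lambertKernel_strictMonoOn (Set.mem_Ioi.2 (by positivity)) (Set.mem_Ioi.2 (by positivity))
        (by nlinarith)
    have he : Real.exp s * Real.exp (-((k + 1) * (2 * s))) = Real.exp (-((2 * k + 1) * s)) := by
      rw [← Real.exp_add]; ring_nf
    simp only [hh, hH]
    rw [← mul_assoc, he]
    push_cast
    exact mul_lt_mul_of_pos_left hk (Real.exp_pos _)
  have hse : Summable fun k => h (2 * k) :=
    hsum.comp_injective (mul_right_injective₀ (two_ne_zero' ℕ))
  have hso : Summable fun k => h (2 * k + 1) := by simpa only [hodd] using hsum2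
  have hlt : ∑' k, h (2 * k) < Real.exp s * ∑' k, H k := by
    rw [← tsum_mul_left]
    exact hse.tsum_lt_tsum (fun k => (heven k).le) (heven 0) (hsum2.mul_left _)
  have hsplit := tsum_even_add_odd hse hso
  simp only [hodd] at hsplit
  have he : Real.exp (2 * s) = Real.exp s * Real.exp s := by rw [← Real.exp_add]; ring_nf
  have hp := exp_sub_one_pos hs
  calc lambertAverage s = (Real.exp s - 1) * ∑' n, h n := rfl
    _ < (Real.exp s - 1) * ((Real.exp s + 1) * ∑' n, H n) := by
        refine mul_lt_mul_of_pos_left ?_ hp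
        rw [← hsplit]
        linarith
    _ = lambertAverage (2 * s) := by
        change _ = (Real.exp (2 * s) - 1) * ∑' n, H n
        rw [he]
        ring

/-! ### The Lambert series in terms of the average -/

lemma hasSum_inv_exp_sub_one_sub_log {t : ℝ} (ht : 0 < t) :
    HasSum (fun n : ℕ => 1 / (Real.exp ((n + 1) * t) - 1)
        - Real.exp (-((n + 1) * t)) / ((n + 1) * t))
      (∑' n : ℕ, Real.exp (-((n + 1) * t)) * lambertKernel ((n + 1) * t)) := by
  convert (summable_lambertAverage ht).hasSum using 2 with n
  have hc : (0 : ℝ) < (n + 1) * t := by positivity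
  generalize ((n : ℝ) + 1) * t = c at *
  have h1 := one_sub_exp_neg_pos hc
  have h2 := exp_sub_one_pos hc
  have h3 : Real.exp c * Real.exp (-c) = 1 := by rw [← Real.exp_add]; simp
  have h4 : 1 / (Real.exp c - 1) = Real.exp (-c) * (1 / (1 - Real.exp (-c))) := by
    field_simp
    linarith
  rw [h4, lambertKernel]
  ring

lemma hasSum_log_one_sub_exp_neg {t : ℝ} (ht : 0 < t) :
    HasSum (fun n : ℕ => Real.exp (-((n + 1) * t)) / ((n + 1) * t))
      (-Real.log (1 - Real.exp (-t)) / t) := by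
  have h := one_sub_exp_neg_pos ht
  have := (Real.hasSum_pow_div_log_of_abs_lt_one (x := Real.exp (-t))
    (by rw [abs_of_pos (Real.exp_pos _)]; linarith)).div_const t
  simpa only [exp_neg_succ_mul, div_div] using this

lemma hasSum_inv_exp_sub_one {t : ℝ} (ht : 0 < t) :
    HasSum (fun n : ℕ => 1 / (Real.exp ((n + 1) * t) - 1))
      (lambertAverage t / (Real.exp t - 1) - Real.log (1 - Real.exp (-t)) / t) := by
  have h := (hasSum_inv_exp_sub_one_sub_log ht).add (hasSum_log_one_sub_exp_neg ht)
  convert h using 2 with n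
  · ring
  · rw [lambertAverage, mul_div_cancel_left₀ _ (exp_sub_one_pos ht).ne']
    ring

/-! ### The limit `γ` at `t → 0` -/

/-- The summand `f(n+1) - ∫_{n+1}^{n+2} f` with `f(x) = (e^t - 1) / (e^{tx} - 1)`. -/
noncomputable def lambertDefect (t : ℝ) (n : ℕ) : ℝ :=
  (Real.exp t - 1) * (1 / (Real.exp ((n + 1) * t) - 1)
    - Real.log ((1 - Real.exp (-((n + 2) * t))) / (1 - Real.exp (-((n + 1) * t)))) / t)

/-- The left side is `∫ dx / (e^{tx} - 1)` over `[n+1, n+2]`; the bound is the integrand's value at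
the left endpoint, obtained from `log x ≤ x - 1`. -/
lemma log_ratio_le {t : ℝ} (ht : 0 < t) (n : ℕ) :
    Real.log ((1 - Real.exp (-((n + 2) * t))) / (1 - Real.exp (-((n + 1) * t)))) / t
      ≤ 1 / (Real.exp ((n + 1) * t) - 1) := by
  have hc : (0 : ℝ) < (n + 1) * t := by positivity
  have hc' : (0 : ℝ) < (n + 2) * t := by positivity
  have e : Real.exp (-((n + 2) * t)) = Real.exp (-((n + 1) * t)) * Real.exp (-t) := by
    rw [← Real.exp_add]; ring_nf
  have h1 := one_sub_exp_neg_pos hc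
  have h1' := one_sub_exp_neg_pos hc'
  have h2 := exp_sub_one_pos hc
  have h4 : 1 / (Real.exp ((n + 1) * t) - 1)
      = Real.exp (-((n + 1) * t)) / (1 - Real.exp (-((n + 1) * t))) := by
    have h3 : Real.exp ((n + 1) * t) * Real.exp (-((n + 1) * t)) = 1 := by
      rw [← Real.exp_add]; simp
    field_simp
    linarith
  have h5 := Real.log_le_sub_one_of_pos (div_pos h1' h1)
  have h6 : 1 - Real.exp (-t) ≤ t := by linarith [Real.add_one_le_exp (-t)]
  rw [h4, div_le_iff₀ ht]
  refine h5.trans ?_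
  rw [div_sub_one h1.ne', div_mul_eq_mul_div, e]
  gcongr
  nlinarith [Real.exp_pos (-((n + 1) * t))]

lemma le_log_ratio {t : ℝ} (ht : 0 < t) (n : ℕ) :
    1 / (Real.exp ((n + 2) * t) - 1)
      ≤ Real.log ((1 - Real.exp (-((n + 2) * t))) / (1 - Real.exp (-((n + 1) * t)))) / t := by
  have hc : (0 : ℝ) < (n + 1) * t := by positivity
  have hc' : (0 : ℝ) < (n + 2) * t := by positivity
  have e : Real.exp (-((n + 1) * t)) = Real.exp (-((n + 2) * t)) * Real.exp t := by
    rw [← Real.exp_add]; ring_nf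
  have h1 := one_sub_exp_neg_pos hc
  have h1' := one_sub_exp_neg_pos hc'
  have h2 := exp_sub_one_pos hc'
  have h4 : 1 / (Real.exp ((n + 2) * t) - 1)
      = Real.exp (-((n + 2) * t)) / (1 - Real.exp (-((n + 2) * t))) := by
    have h3 : Real.exp ((n + 2) * t) * Real.exp (-((n + 2) * t)) = 1 := by
      rw [← Real.exp_add]; simp
    field_simp
    linarith
  have h5 := Real.one_sub_inv_le_log_of_pos (div_pos h1' h1)
  have h6 : t ≤ Real.exp t - 1 := by linarith [Real.add_one_le_exp t]
  rw [h4, le_div_iff₀ ht]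
  refine le_trans ?_ h5
  rw [inv_div, one_sub_div h1'.ne', div_mul_eq_mul_div, e]
  gcongr
  nlinarith [Real.exp_pos (-((n + 2) * t))]

lemma lambertDefect_nonneg {t : ℝ} (ht : 0 < t) (n : ℕ) : 0 ≤ lambertDefect t n :=
  mul_nonneg (exp_sub_one_pos ht).le (sub_nonneg.2 (log_ratio_le ht n))

lemma lambertDefect_le {t : ℝ} (ht : 0 < t) (ht1 : t ≤ 1) (n : ℕ) :
    lambertDefect t n ≤ 4 * (1 / ((n : ℝ) + 1) ^ 2) := by
  have hc : (0 : ℝ) < (n + 1) * t := by positivity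
  have hc' : (0 : ℝ) < (n + 2) * t := by positivity
  have h0 := exp_sub_one_pos ht
  have h2 : Real.exp t - 1 ≤ 2 * t := by
    have := Real.abs_exp_sub_one_le (x := t) (by rwa [abs_of_pos ht])
    rw [abs_of_pos ht] at this
    exact (le_abs_self _).trans this
  have hA := exp_sub_one_pos hc
  have hB := exp_sub_one_pos hc'
  set E := Real.exp ((n + 1) * t) with hE
  have e : Real.exp ((n + 2) * t) = E * Real.exp t := by
    rw [hE, ← Real.exp_add]; ring_nf
  have hEpos : 0 < E := Real.exp_pos _
  have hsq : ((n + 1) * t) ^ 2 * E ≤ (E - 1) ^ 2 := by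
    have h1 := mul_exp_neg_half_lt_one_sub_exp_neg hc
    have h3 : Real.exp (-((n + 1) * t / 2)) ^ 2 * E = 1 := by
      rw [hE, ← Real.exp_nat_mul, ← Real.exp_add]
      push_cast
      ring_nf
      simp
    have h4 : Real.exp (-((n + 1) * t)) * E = 1 := by
      rw [hE, ← Real.exp_add]; simp
    have h5 := pow_le_pow_left₀ (by positivity) h1.le 2
    have h6 := mul_le_mul_of_nonneg_right h5 (sq_nonneg E)
    calc ((n + 1) * t) ^ 2 * E
        = ((n + 1) * t * Real.exp (-((n + 1) * t / 2))) ^ 2 * E ^ 2 := by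
          rw [mul_pow _ (Real.exp _), sq E, mul_assoc, ← mul_assoc _ E E, h3, one_mul]
      _ ≤ (1 - Real.exp (-((n + 1) * t))) ^ 2 * E ^ 2 := h6
      _ = (E - Real.exp (-((n + 1) * t)) * E) ^ 2 := by ring
      _ = (E - 1) ^ 2 := by rw [h4]
  -- Replacing the integral by the right-endpoint value leaves a difference of consecutive terms of
  -- size `O(1/n²)`, uniformly in `t ≤ 1`.
  have hle : lambertDefect t n
      ≤ (Real.exp t - 1) * (1 / (E - 1) - 1 / (Real.exp ((n + 2) * t) - 1)) := by
    refine mul_le_mul_of_nonneg_left ?_ h0.le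
    exact sub_le_sub_left (le_log_ratio ht n) _
  refine hle.trans ?_
  have hEB : E - 1 ≤ Real.exp ((n + 2) * t) - 1 := by
    rw [e]
    nlinarith
  calc (Real.exp t - 1) * (1 / (E - 1) - 1 / (Real.exp ((n + 2) * t) - 1))
      = (Real.exp t - 1) ^ 2 * E / ((E - 1) * (Real.exp ((n + 2) * t) - 1)) := by
        rw [div_sub_div _ _ hA.ne' hB.ne', e]
        ring
    _ ≤ (2 * t) ^ 2 * E / ((E - 1) * (E - 1)) := by
        gcongr
    _ ≤ 4 * (1 / ((n : ℝ) + 1) ^ 2) := by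
        rw [mul_one_div, div_le_div_iff₀ (by positivity) (by positivity)]
        nlinarith

/-- The integrals telescope to exactly the logarithmic term of `hasSum_inv_exp_sub_one`, so only the
average survives. -/
lemma tsum_lambertDefect {t : ℝ} (ht : 0 < t) : ∑' n, lambertDefect t n = lambertAverage t := by
  have hsum : HasSum (fun n : ℕ => Real.log ((1 - Real.exp (-((n + 2) * t))) /
      (1 - Real.exp (-((n + 1) * t)))) / t) (-Real.log (1 - Real.exp (-t)) / t) := by
    rw [hasSum_iff_tendsto_nat_of_nonneg fun n =>
      (one_div_pos.2 (exp_sub_one_pos (by positivity))).le.trans (le_log_ratio ht n)]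
    have htel : ∀ N : ℕ, ∑ n ∈ Finset.range N, Real.log ((1 - Real.exp (-((n + 2) * t))) /
        (1 - Real.exp (-((n + 1) * t)))) / t
        = (Real.log (1 - Real.exp (-((N + 1) * t))) - Real.log (1 - Real.exp (-t))) / t := by
      intro N
      rw [← Finset.sum_div]
      congr 1
      have := Finset.sum_range_sub (fun n : ℕ => Real.log (1 - Real.exp (-((n + 1) * t)))) N
      simp only [Nat.cast_zero, zero_add, one_mul] at this
      rw [← this]
      refine Finset.sum_congr rfl fun n _ => ?_
      rw [Real.log_div (one_sub_exp_neg_pos (by positivity)).ne'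
        (one_sub_exp_neg_pos (by positivity)).ne']
      push_cast
      ring_nf
    simp_rw [htel]
    have h1 : Tendsto (fun N : ℕ => Real.exp (-(((N : ℝ) + 1) * t))) atTop (𝓝 0) :=
      (hasSum_exp_neg_succ_mul ht).summable.tendsto_atTop_zero
    have h2 : Tendsto (fun N : ℕ => Real.log (1 - Real.exp (-(((N : ℝ) + 1) * t)))) atTop
        (𝓝 0) := by
      have := (h1.const_sub 1).log (by norm_num)
      simpa using this
    simpa using (h2.sub_const (Real.log (1 - Real.exp (-t)))).div_const t
  have h := ((hasSum_inv_exp_sub_one ht).sub hsum).mul_left (Real.exp t - 1)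
  have h' : HasSum (lambertDefect t) _ := h
  rw [h'.tsum_eq]
  have := exp_sub_one_pos ht
  field_simp
  ring

lemma hasSum_eulerMascheroniConstant :
    HasSum (fun n : ℕ => 1 / ((n : ℝ) + 1) - Real.log (((n : ℝ) + 2) / (n + 1)))
      Real.eulerMascheroniConstant := by
  rw [hasSum_iff_tendsto_nat_of_nonneg]
  · convert Real.tendsto_eulerMascheroniSeq using 2 with N
    rw [Real.eulerMascheroniSeq, harmonic, Finset.sum_sub_distrib]
    congr 1
    · push_cast
      simp
    · have := Finset.sum_range_sub (fun n : ℕ => Real.log ((n : ℝ) + 1)) N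
      simp only [Nat.cast_zero, zero_add, Real.log_one, sub_zero] at this
      rw [← this]
      refine Finset.sum_congr rfl fun n _ => ?_
      rw [Real.log_div (by positivity) (by positivity)]
      push_cast
      ring_nf
  · intro n
    have := Real.log_le_sub_one_of_pos (x := ((n : ℝ) + 2) / (n + 1)) (by positivity)
    have h : ((n : ℝ) + 2) / (n + 1) - 1 = 1 / (n + 1) := by
      field_simp
      ring
    linarith

lemma tendsto_exp_mul_sub_one_div (a : ℝ) :
    Tendsto (fun t : ℝ => (Real.exp (a * t) - 1) / t) (𝓝[>] 0) (𝓝 a) := by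
  have h : HasDerivAt (fun t : ℝ => Real.exp (a * t)) a 0 := by
    simpa using ((hasDerivAt_id (0 : ℝ)).const_mul a).exp
  have h1 := h.tendsto_slope_zero_right
  refine h1.congr fun t => ?_
  simp [div_eq_inv_mul]

lemma tendsto_lambertDefect (n : ℕ) :
    Tendsto (fun t => lambertDefect t n) (𝓝[>] 0)
      (𝓝 (1 / ((n : ℝ) + 1) - Real.log (((n : ℝ) + 2) / (n + 1)))) := by
  have hd := tendsto_exp_mul_sub_one_div
  have hpos : (0 : ℝ) < n + 1 := by positivity
  have hpos' : (0 : ℝ) < n + 2 := by positivity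
  have h1 : Tendsto (fun t : ℝ => (Real.exp t - 1) / t) (𝓝[>] 0) (𝓝 1) := by
    simpa using hd 1
  have h2 := h1.div (hd (n + 1)) hpos.ne'
  have h3 := ((hd (-(n + 2))).neg.div (hd (-(n + 1))).neg (by simpa using hpos.ne'))
  rw [neg_neg, neg_neg] at h3
  have h4 := h2.sub (h1.mul (h3.log (by positivity)))
  rw [one_mul] at h4
  refine h4.congr' ?_
  filter_upwards [self_mem_nhdsWithin] with t ht
  have ht : 0 < t := ht
  have hA := exp_sub_one_pos (show (0 : ℝ) < (n + 1) * t by positivity)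
  have hB := one_sub_exp_neg_pos (show (0 : ℝ) < (n + 1) * t by positivity)
  simp only [Pi.div_apply, lambertDefect]
  have e1 : -((Real.exp (-((n : ℝ) + 2) * t) - 1) / t) /
        -((Real.exp (-((n : ℝ) + 1) * t) - 1) / t)
      = (1 - Real.exp (-((n + 2) * t))) / (1 - Real.exp (-((n + 1) * t))) := by
    rw [← neg_div, ← neg_div, neg_sub, neg_sub, div_div_div_cancel_right₀ ht.ne',
      neg_mul, neg_mul]
  rw [e1, div_div_div_cancel_right₀ ht.ne']
  ring

lemma tendsto_lambertAverage :
    Tendsto lambertAverage (𝓝[>] 0) (𝓝 Real.eulerMascheroniConstant) := by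
  have hb : Summable fun n : ℕ => 4 * (1 / ((n : ℝ) + 1) ^ 2) := by
    have := (summable_nat_add_iff 1).2 (Real.summable_one_div_nat_pow.2 one_lt_two)
    simpa using! this.mul_left 4
  have h := tendsto_tsum_of_dominated_convergence (𝓕 := 𝓝[>] (0 : ℝ)) hb
    tendsto_lambertDefect (by
      filter_upwards [Ioc_mem_nhdsGT (zero_lt_one' ℝ)] with t ht n
      rw [Real.norm_of_nonneg (lambertDefect_nonneg ht.1 n)]
      exact lambertDefect_le ht.1 ht.2 n)
  rw [hasSum_eulerMascheroniConstant.tsum_eq] at h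
  refine h.congr' ?_
  filter_upwards [self_mem_nhdsWithin] with t ht
  exact tsum_lambertDefect ht

lemma eulerMascheroniConstant_lt_lambertAverage {t : ℝ} (ht : 0 < t) :
    Real.eulerMascheroniConstant < lambertAverage t := by
  have hpos : ∀ n : ℕ, 0 < t / 2 / 2 ^ n := fun n => by positivity
  have hanti : Antitone fun n : ℕ => lambertAverage (t / 2 / 2 ^ n) := by
    refine antitone_nat_of_succ_le fun n => ?_
    have := lambertAverage_lt_lambertAverage_two_mul (hpos (n + 1))
    refine this.le.trans_eq (congrArg _ ?_)
    rw [pow_succ]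
    field_simp
  have hlim : Tendsto (fun n : ℕ => t / 2 / 2 ^ n) atTop (𝓝[>] 0) := by
    refine tendsto_nhdsWithin_iff.2 ⟨?_, .of_forall hpos⟩
    exact tendsto_const_nhds.div_atTop (tendsto_pow_atTop_atTop_of_one_lt one_lt_two)
  have hle := hanti.le_of_tendsto (tendsto_lambertAverage.comp hlim) 0
  -- The limit along halvings gives only `γ ≤ A(t/2)`; one more doubling makes it strict.
  have hlt := lambertAverage_lt_lambertAverage_two_mul (half_pos ht)
  rw [mul_div_cancel₀ t two_ne_zero] at hlt
  simp only [pow_zero, div_one] at hle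
  exact hle.trans_lt hlt

/-! ### The divisor series as a product -/

lemma tsum_card_divisors_mul_pow {q : ℝ} (hq : |q| < 1) :
    ∑' n : ℕ, ((n + 1).divisors.card : ℝ) * q ^ (n + 1)
      = ∑' n : ℕ, q ^ (n + 1) / (1 - q ^ (n + 1)) := by
  have h := tsum_pow_div_one_sub_eq_tsum_sigma (𝕜 := ℝ) (r := q) (by rwa [Real.norm_eq_abs]) 0
  rw [tsum_pnat_eq_tsum_succ (f := fun n : ℕ => (n : ℝ) ^ 0 * q ^ n / (1 - q ^ n)),
    tsum_pnat_eq_tsum_succ (f := fun n : ℕ => (ArithmeticFunction.sigma 0 n : ℝ) * q ^ n)] at h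
  simpa [ArithmeticFunction.sigma_zero_apply] using h.symm

lemma summable_card_divisors_mul_pow {q : ℝ} (hq : |q| < 1) :
    Summable fun n : ℕ => ‖((n + 1).divisors.card : ℝ) * q ^ (n + 1)‖ := by
  have h := (summable_nat_add_iff 1).2
    (summable_norm_pow_mul_geometric_of_norm_lt_one 1 (r := q) (by rwa [Real.norm_eq_abs]))
  refine Summable.of_nonneg_of_le (fun n => norm_nonneg _) (fun n => ?_) h
  rw [norm_mul, norm_mul, pow_one, Real.norm_natCast, Real.norm_natCast]
  gcongr
  exact Nat.card_divisors_le_self _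

lemma sum_antidiagonal_eq_divisorConvCoeff (q : ℝ) (n : ℕ) :
    ∑ kl ∈ Finset.HasAntidiagonal.antidiagonal n,
      ((kl.1 + 1).divisors.card : ℝ) * q ^ (kl.1 + 1) *
      (q ^ (kl.2 + 1) / (kl.2 + 1)) = divisorConvCoeff (n + 2) * q ^ (n + 2) := by
  rw [Finset.Nat.sum_antidiagonal_eq_sum_range_succ_mk, divisorConvCoeff,
    Finset.sum_Ico_eq_sum_range, Finset.sum_mul]
  refine Finset.sum_congr (by simp) fun i hi => ?_
  have hi : i ≤ n := by simpa [Nat.lt_succ_iff] using hi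
  have hp : q ^ (n + 2) = q ^ (i + 1) * q ^ (n - i + 1) := by
    rw [← pow_add]
    congr 1
    omega
  have hsub : ((n + 2 : ℕ) : ℝ) - ((1 + i : ℕ) : ℝ) = ((n - i : ℕ) : ℝ) + 1 := by
    push_cast [Nat.cast_sub hi]
    ring
  rw [hsub, hp, add_comm 1 i]
  ring

lemma summable_pow_succ_div {q : ℝ} (hq : |q| < 1) :
    Summable fun n : ℕ => ‖q ^ (n + 1) / ((n : ℝ) + 1)‖ := by
  have h := (Real.hasSum_pow_div_log_of_abs_lt_one (x := |q|) (by rwa [abs_abs])).summable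
  refine h.congr fun n => ?_
  rw [norm_div, norm_pow, Real.norm_eq_abs, Real.norm_of_nonneg (by positivity)]

lemma summable_divisorConvCoeff {q : ℝ} (hq : |q| < 1) :
    Summable fun n : ℕ => divisorConvCoeff (n + 2) * q ^ (n + 2) := by
  refine (summable_norm_sum_mul_antidiagonal_of_summable_norm
    (summable_card_divisors_mul_pow hq) (summable_pow_succ_div hq)).of_norm.congr fun n => ?_
  exact sum_antidiagonal_eq_divisorConvCoeff q n

lemma divisorConvSeries_eq {q : ℝ} (hq : |q| < 1) :
    divisorConvSeries q
      = (∑' n : ℕ, q ^ (n + 1) / (1 - q ^ (n + 1))) * -Real.log (1 - q) := by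
  rw [← tsum_card_divisors_mul_pow hq, ← (Real.hasSum_pow_div_log_of_abs_lt_one hq).tsum_eq,
    tsum_mul_tsum_eq_tsum_sum_antidiagonal_of_summable_norm
      (summable_card_divisors_mul_pow hq) (summable_pow_succ_div hq), divisorConvSeries]
  exact tsum_congr fun n => (sum_antidiagonal_eq_divisorConvCoeff q n).symm

/-- Keeping `c` arbitrary lets one identity serve both the inequalities and their sharpness: the
last summand has the sign of `A(t) + c`. -/
lemma divisorConvSeries_exp_neg {t : ℝ} (ht : 0 < t) (c : ℝ) :
    divisorConvSeries (Real.exp (-t))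
      = c * (Real.exp (-t) * Real.log (1 - Real.exp (-t)) / (1 - Real.exp (-t)))
        - Real.log (1 - Real.exp (-t)) ^ 2 / Real.log (Real.exp (-t))
        + -Real.log (1 - Real.exp (-t)) / (Real.exp t - 1) * (lambertAverage t + c) := by
  have h1 := one_sub_exp_neg_pos ht
  have h2 := exp_sub_one_pos ht
  have hq : |Real.exp (-t)| < 1 := by rw [abs_of_pos (Real.exp_pos _)]; linarith
  have hterm : ∀ {x : ℝ}, 0 < x →
      Real.exp (-x) / (1 - Real.exp (-x)) = 1 / (Real.exp x - 1) := by
    intro x hx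
    have h3 : Real.exp x * Real.exp (-x) = 1 := by rw [← Real.exp_add]; simp
    rw [div_eq_div_iff (one_sub_exp_neg_pos hx).ne' (exp_sub_one_pos hx).ne']
    linarith
  have hL : ∑' n : ℕ, Real.exp (-t) ^ (n + 1) / (1 - Real.exp (-t) ^ (n + 1))
      = lambertAverage t / (Real.exp t - 1) - Real.log (1 - Real.exp (-t)) / t := by
    rw [← (hasSum_inv_exp_sub_one ht).tsum_eq]
    refine tsum_congr fun n => ?_
    rw [← exp_neg_succ_mul, hterm (by positivity)]
  rw [divisorConvSeries_eq hq, hL, Real.log_exp, mul_div_right_comm (Real.exp (-t)), hterm ht]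
  generalize Real.log (1 - Real.exp (-t)) = l
  field_simp
  ring

lemma lt_divisorConvSeries_exp_neg_iff {t : ℝ} (ht : 0 < t) (c : ℝ) :
    c * (Real.exp (-t) * Real.log (1 - Real.exp (-t)) / (1 - Real.exp (-t)))
        - Real.log (1 - Real.exp (-t)) ^ 2 / Real.log (Real.exp (-t))
      < divisorConvSeries (Real.exp (-t)) ↔ -c < lambertAverage t := by
  have h1 := one_sub_exp_neg_pos ht
  have hl : 0 < -Real.log (1 - Real.exp (-t)) / (Real.exp t - 1) :=
    div_pos (neg_pos.2 (Real.log_neg h1 (by linarith [Real.exp_pos (-t)]))) (exp_sub_one_pos ht)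
  rw [divisorConvSeries_exp_neg ht c, lt_add_iff_pos_right, mul_pos_iff_of_pos_left hl,
    neg_lt_iff_pos_add]

lemma divisorConvSeries_exp_neg_lt_iff {t : ℝ} (ht : 0 < t) (c : ℝ) :
    divisorConvSeries (Real.exp (-t))
      < c * (Real.exp (-t) * Real.log (1 - Real.exp (-t)) / (1 - Real.exp (-t)))
        - Real.log (1 - Real.exp (-t)) ^ 2 / Real.log (Real.exp (-t))
      ↔ lambertAverage t < -c := by
  have h1 := one_sub_exp_neg_pos ht
  have hl : 0 < -Real.log (1 - Real.exp (-t)) / (Real.exp t - 1) :=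
    div_pos (neg_pos.2 (Real.log_neg h1 (by linarith [Real.exp_pos (-t)]))) (exp_sub_one_pos ht)
  rw [divisorConvSeries_exp_neg ht c, add_lt_iff_neg_left, ← not_le,
    mul_nonneg_iff_of_pos_left hl, not_le, lt_neg_iff_add_neg]

theorem theorem4p4 :
    (∀ q : ℝ, 0 < q → q < 1 →
      Summable (fun n : ℕ => divisorConvCoeff (n + 2) * q ^ (n + 2)) ∧
      -Real.eulerMascheroniConstant * (q * Real.log (1 - q) / (1 - q))
          - Real.log (1 - q) ^ 2 / Real.log q < divisorConvSeries q ∧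
      divisorConvSeries q
        < (-1) * (q * Real.log (1 - q) / (1 - q)) - Real.log (1 - q) ^ 2 / Real.log q) ∧
    (∀ lam : ℝ,
      (∀ q : ℝ, 0 < q → q < 1 →
        lam * (q * Real.log (1 - q) / (1 - q)) - Real.log (1 - q) ^ 2 / Real.log q
          < divisorConvSeries q) →
      -Real.eulerMascheroniConstant ≤ lam) ∧
    (∀ mu : ℝ,
      (∀ q : ℝ, 0 < q → q < 1 →
        divisorConvSeries q
          < mu * (q * Real.log (1 - q) / (1 - q)) - Real.log (1 - q) ^ 2 / Real.log q) →
      mu ≤ -1) := by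
  refine ⟨fun q hq0 hq1 => ?_, fun lam h => ?_, fun mu h => ?_⟩
  · refine ⟨summable_divisorConvCoeff (by rwa [abs_of_pos hq0]), ?_⟩
    obtain ⟨t, ht, rfl⟩ : ∃ t : ℝ, 0 < t ∧ Real.exp (-t) = q :=
      ⟨-Real.log q, neg_pos.2 (Real.log_neg hq0 hq1), by rw [neg_neg, Real.exp_log hq0]⟩
    rw [lt_divisorConvSeries_exp_neg_iff ht, divisorConvSeries_exp_neg_lt_iff ht, neg_neg, neg_neg]
    exact ⟨eulerMascheroniConstant_lt_lambertAverage ht, lambertAverage_lt_one ht⟩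
  · rw [neg_le]
    refine ge_of_tendsto tendsto_lambertAverage ?_
    filter_upwards [self_mem_nhdsWithin] with t ht
    have ht : 0 < t := ht
    exact ((lt_divisorConvSeries_exp_neg_iff ht lam).1
      (h _ (Real.exp_pos _) (Real.exp_lt_one_iff.2 (by linarith)))).le
  · rw [le_neg]
    have hlim : Tendsto (fun t : ℝ => 1 - 1 / t) atTop (𝓝 1) := by
      simpa using (tendsto_inv_atTop_zero (𝕜 := ℝ)).const_sub 1
    refine le_of_tendsto hlim ?_
    filter_upwards [eventually_gt_atTop 0] with t ht
    exact (one_sub_inv_le_lambertAverage ht).trans ((divisorConvSeries_exp_neg_lt_iff ht mu).1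
      (h _ (Real.exp_pos _) (Real.exp_lt_one_iff.2 (by linarith)))).le
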